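/- Let $d\ge 0$ be an integer and let $A$ be a $d\times d$ integer matrix which is expansive, i.e. every complex eigenvalue of $A$ has absolute value strictly greater than $1$. Let $B,L\subset\mathbb{Z}^d$ be finite sets of the same cardinality $|B|=|L|=:N$ with $0\in B$ and $0\in L$, and assume that $(A,B,L)$ is a Hadamard triple, i.e. the matrix $\frac{1}{\sqrt N}\left(e^{2\pi i\,A^{-1}b\cdot l}\right)_{b\in B,\,l\in L}$ is unitary. Let $\mu_B$ be the invariant measure of the iterated function system $\tau_b(x)=A^{-1}(x+b)$ $(b\in B)$, i.e. the unique Borel probability measure on $\mathbb{R}^d$ such that $\mu_B(S)=\frac1N\sum_{b\in B}\mu_B(\tau_b^{-1}(S))$ for all Borel sets $S\subset\mathbb{R}^d$. Put $$m_B(x)=\frac1N\sum_{b\in B}e^{2\pi i\,b\cdot x},\qquad \sigma_l(x)=(A^T)^{-1}(x+l)\quad(x\in\mathbb{R}^d,\ l\in L),$$ $$\Lambda_0=\Big\{\sum_{k=0}^n (A^T)^k l_k \ :\ n\in\mathbb{N},\ l_0,\dots,l_n\in L\Big\},$$ where $\mathbb{N}$ includes $0$, and for $f:\mathbb{R}^d\to\mathbb{C}$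 define $$(R_{m_B}f)(x)=\sum_{l\in L}|m_B(\sigma_l(x))|^2 f(\sigma_l(x))\qquad(x\in\mathbb{R}^d).$$ Then the following are equivalent: (a) $\Lambda_0$ is a spectrum for $\mu_B$, i.e. the functions $x\mapsto e^{2\pi i\lambda\cdot x}$, $\lambda\in\Lambda_0$, form an orthonormal basis of $L^2(\mu_B)$; (b) the continuous functions $f:\mathbb{R}^d\to\mathbb{C}$ with $R_{m_B}f=f$ are exactly the constant functions. -/

import Mathlib

open MeasureTheory
open scoped ENNReal NNReal Matrix Topology RealInnerProductSpace

namespace AffineIFS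

/-- The Euclidean space `ℝ^d`. -/
abbrev E (d : ℕ) : Type := EuclideanSpace ℝ (Fin d)

/-- An integer vector, seen as a point of `ℝ^d`. -/
noncomputable def vec {d : ℕ} (v : Fin d → ℤ) : E d :=
  WithLp.toLp 2 (fun i => (v i : ℝ))

/-- The linear operator `x ↦ A⁻¹ x` on `ℝ^d` defined by an integer matrix `A`. -/
noncomputable def invCLM {d : ℕ} (A : Matrix (Fin d) (Fin d) ℤ) : E d →L[ℝ] E d :=
  Matrix.toEuclideanCLM (𝕜 := ℝ) (A.map (Int.cast : ℤ → ℝ))⁻¹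

/-- An integer matrix is expansive if all its complex eigenvalues have absolute value
strictly greater than `1`. In particular it is invertible over `ℝ`. -/
def IsExpansive {d : ℕ} (A : Matrix (Fin d) (Fin d) ℤ) : Prop :=
  ∀ z ∈ spectrum ℂ (A.map (Int.cast : ℤ → ℂ)), 1 < ‖z‖

/-- The maps `τ_b x = A⁻¹ (x + b)` of the affine iterated function system. -/
noncomputable def tau {d : ℕ} (A : Matrix (Fin d) (Fin d) ℤ) (b : Fin d → ℤ) (x : E d) : E d :=
  invCLM A (x + vec b)

/-- The maps `σ_l x = (Aᵀ)⁻¹ (x + l)` of the dual iterated function system. -/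
noncomputable def sigma {d : ℕ} (A : Matrix (Fin d) (Fin d) ℤ) (l : Fin d → ℤ) (x : E d) : E d :=
  invCLM Aᵀ (x + vec l)

/-- The exponential `e_lam x = e^{2π i lam · x}`. -/
noncomputable def expo {d : ℕ} (lam x : E d) : ℂ :=
  Complex.exp (2 * Real.pi * Complex.I * (⟪lam, x⟫ : ℝ))

/-- `Λ` is a spectrum of `μ`: the exponentials `e_lam`, `lam ∈ Λ`, form an orthonormal basis
(a complete orthonormal family) of the complex Hilbert space `L²(μ)`. -/
def IsSpectrum {d : ℕ} (μ : Measure (E d)) (Λ : Set (E d)) : Prop :=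
  ∃ e : HilbertBasis Λ ℂ (Lp ℂ 2 μ), ∀ lam : Λ, (e lam : E d → ℂ) =ᵐ[μ] expo (lam : E d)

/-- The matrix `N^{-1/2} (e^{2π i A⁻¹ b · l})`, `b ∈ B`, `l ∈ L`, where `N = |B|`. -/
noncomputable def hadamardMatrix {d : ℕ} (A : Matrix (Fin d) (Fin d) ℤ)
    (B L : Finset (Fin d → ℤ)) : Matrix B L ℂ :=
  Matrix.of fun b l =>
    ((1 / √(B.card : ℝ) : ℝ) : ℂ) * expo (invCLM A (vec (b : Fin d → ℤ))) (vec (l : Fin d → ℤ))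

/-- `(A, B, L)` is a Hadamard triple: `|B| = |L|` and `hadamardMatrix A B L` is unitary. -/
def IsHadamardTriple {d : ℕ} (A : Matrix (Fin d) (Fin d) ℤ) (B L : Finset (Fin d → ℤ)) : Prop :=
  B.card = L.card ∧
    hadamardMatrix A B L * (hadamardMatrix A B L)ᴴ = 1 ∧
    (hadamardMatrix A B L)ᴴ * hadamardMatrix A B L = 1

/-- The low-pass filter `m_B x = N⁻¹ ∑_{b ∈ B} e^{2π i b · x}`. -/
noncomputable def lowPass {d : ℕ} (B : Finset (Fin d → ℤ)) (x : E d) : ℂ :=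
  (B.card : ℂ)⁻¹ * ∑ b ∈ B, expo (vec b) x

/-- The transfer operator `(R f) x = ∑_{l ∈ L} |m_B (σ_l x)|² f (σ_l x)`. -/
noncomputable def transferOperator {d : ℕ} (A : Matrix (Fin d) (Fin d) ℤ)
    (B L : Finset (Fin d → ℤ)) (f : E d → ℂ) (x : E d) : ℂ :=
  ∑ l ∈ L, ((‖lowPass B (sigma A l x)‖ ^ 2 : ℝ) : ℂ) * f (sigma A l x)

/-- The set `Λ₀` of all finite sums `∑_{k=0}^n (Aᵀ)^k l_k` with digits `l_k ∈ L`. -/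
def lambdaZero {d : ℕ} (A : Matrix (Fin d) (Fin d) ℤ) (L : Finset (Fin d → ℤ)) : Set (E d) :=
  {x | ∃ (n : ℕ) (l : ℕ → Fin d → ℤ), (∀ k, l k ∈ L) ∧
    x = vec (∑ k ∈ Finset.range (n + 1), (Aᵀ ^ k) *ᵥ l k)}

/-- `μ` is a Borel probability measure satisfying the invariance equation
`μ S = N⁻¹ ∑_{b ∈ B} μ (τ_b⁻¹ S)` for all Borel sets `S`. -/
def IsInvariantProbability {d : ℕ} (A : Matrix (Fin d) (Fin d) ℤ) (B : Finset (Fin d → ℤ))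
    (μ : Measure (E d)) : Prop :=
  IsProbabilityMeasure μ ∧
    ∀ S : Set (E d), MeasurableSet S →
      μ S = (B.card : ℝ≥0∞)⁻¹ * ∑ b ∈ B, μ (tau A b ⁻¹' S)

/-! ### Existence and uniqueness of the invariant measure -/

section Existence

open Filter

variable {d : ℕ}

theorem norm_invCLM_pow_le (A : Matrix (Fin d) (Fin d) ℤ) (n : ℕ) :
    ‖invCLM A ^ n‖ ≤
      ‖(Matrix.toEuclideanCLM (n := Fin d) (𝕜 := ℂ) (A.map (Int.cast : ℤ → ℂ))⁻¹) ^ n‖ := by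
  have hinv : (A.map (Int.cast : ℤ → ℂ))⁻¹ =
      ((A.map (Int.cast : ℤ → ℝ))⁻¹).map (algebraMap ℝ ℂ) := by
    have h1 : A.map (Int.cast : ℤ → ℂ) =
        (algebraMap ℝ ℂ).mapMatrix (A.map (Int.cast : ℤ → ℝ)) := by
      ext i j; simp
    rw [h1, Matrix.inv_def, Matrix.inv_def, ← RingHom.map_det, ← RingHom.map_adjugate,
      Ring.inverse_eq_inv', Ring.inverse_eq_inv', ← map_inv₀]
    ext i j; simp
  have hpow : ((A.map (Int.cast : ℤ → ℂ))⁻¹) ^ n =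
      (((A.map (Int.cast : ℤ → ℝ))⁻¹) ^ n).map (algebraMap ℝ ℂ) := by
    rw [hinv]
    exact (map_pow ((algebraMap ℝ ℂ).mapMatrix) _ n).symm
  rw [invCLM, ← map_pow, ← map_pow, hpow]
  refine ContinuousLinearMap.opNorm_le_bound _ (norm_nonneg _) fun x => ?_
  set M := ((A.map (Int.cast : ℤ → ℝ))⁻¹) ^ n
  let y : EuclideanSpace ℂ (Fin d) := WithLp.toLp 2 (fun i => (x i : ℂ))
  have hy : ‖y‖ = ‖x‖ := by
    simp [EuclideanSpace.norm_eq, y]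
  have hM : ‖Matrix.toEuclideanCLM (n := Fin d) (𝕜 := ℂ) (M.map (algebraMap ℝ ℂ)) y‖ =
      ‖Matrix.toEuclideanCLM (𝕜 := ℝ) M x‖ := by
    have : ∀ i, (Matrix.toEuclideanCLM (n := Fin d) (𝕜 := ℂ) (M.map (algebraMap ℝ ℂ)) y) i =
        ((Matrix.toEuclideanCLM (𝕜 := ℝ) M x i : ℝ) : ℂ) := by
      intro i
      simp [y, Matrix.mulVec, dotProduct]
    rw [EuclideanSpace.norm_eq, EuclideanSpace.norm_eq]
    simp_rw [this, Complex.norm_real]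
  rw [← hM, ← hy]
  exact ContinuousLinearMap.le_opNorm _ _

theorem summable_norm_invCLM_pow {A : Matrix (Fin d) (Fin d) ℤ} (hA : IsExpansive A) :
    Summable fun n : ℕ => ‖invCLM A ^ n‖ := by
  set AC := A.map (Int.cast : ℤ → ℂ) with hAC
  set T := Matrix.toEuclideanCLM (n := Fin d) (𝕜 := ℂ) AC⁻¹ with hT
  have hspec : spectrum ℂ T = spectrum ℂ AC⁻¹ :=
    AlgEquiv.spectrum_eq (Matrix.toEuclideanCLM (n := Fin d) (𝕜 := ℂ)).toAlgEquiv AC⁻¹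
  have hunit : IsUnit AC := by
    rw [← spectrum.zero_notMem_iff ℂ]
    intro h
    have := hA 0 h
    simp at this
    linarith
  have hlt : ∀ z ∈ spectrum ℂ T, ‖z‖₊ < 1 := by
    intro z hz
    rw [hspec] at hz
    obtain ⟨u, hu⟩ := hunit
    have hui : AC⁻¹ = ((u⁻¹ : (Matrix (Fin d) (Fin d) ℂ)ˣ) : Matrix (Fin d) (Fin d) ℂ) := by
      rw [← hu, Matrix.coe_units_inv]
    rw [hui] at hz
    have hz0 : z ≠ 0 := by
      rintro rfl
      exact (spectrum.zero_notMem_iff ℂ).2 (u⁻¹).isUnit hz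
    have h2 := (spectrum.inv_mem_iff (r := Units.mk0 z hz0) (a := u⁻¹)).1 (by simpa using hz)
    rw [inv_inv, hu] at h2
    have h3 := hA _ h2
    rw [Units.val_inv_eq_inv_val, Units.val_mk0, norm_inv] at h3
    have hzpos : 0 < ‖z‖ := norm_pos_iff.2 hz0
    have : ‖z‖ < 1 := by
      by_contra hcon
      push Not at hcon
      exact absurd h3 (not_lt.2 (inv_le_one_of_one_le₀ hcon))
    exact_mod_cast this
  have hrad : spectralRadius ℂ T < ((1 : ℝ≥0) : ℝ≥0∞) := by
    rcases (spectrum ℂ T).eq_empty_or_nonempty with h | h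
    · simp [spectralRadius, h]
    · exact spectrum.spectralRadius_lt_of_forall_lt_of_nonempty h hlt
  obtain ⟨r, hr1, hr2⟩ := exists_between hrad
  have hev : ∀ᶠ n : ℕ in atTop, (‖T ^ n‖₊ : ℝ≥0∞) ^ (1 / n : ℝ) < r :=
    (spectrum.pow_nnnorm_pow_one_div_tendsto_nhds_spectralRadius T).eventually_lt_const hr1
  lift r to ℝ≥0 using (hr2.trans ENNReal.coe_lt_top).ne
  have hr2' : (r : ℝ) < 1 := by exact_mod_cast hr2
  refine Summable.of_norm_bounded_eventually_nat
    (summable_geometric_of_lt_one r.coe_nonneg hr2') ?_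
  filter_upwards [hev, eventually_gt_atTop 0] with n hn hn0
  have h1 : (‖T ^ n‖₊ : ℝ≥0∞) ≤ (r : ℝ≥0∞) ^ n := by
    have hn0' : (n : ℝ) ≠ 0 := by exact_mod_cast hn0.ne'
    have := ENNReal.rpow_le_rpow hn.le (Nat.cast_nonneg n : (0 : ℝ) ≤ n)
    rwa [← ENNReal.rpow_mul, one_div, inv_mul_cancel₀ hn0', ENNReal.rpow_one,
      ENNReal.rpow_natCast] at this
  have h2 : ‖T ^ n‖ ≤ (r : ℝ) ^ n := by exact_mod_cast h1
  rw [norm_norm]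
  exact (norm_invCLM_pow_le A n).trans h2

theorem measurable_tau (A : Matrix (Fin d) (Fin d) ℤ) (b : Fin d → ℤ) : Measurable (tau A b) := by
  unfold tau
  fun_prop

/-- Existence: the law of `∑_{k ≥ 1} A^{-k} b_k` with independent digits `b_k` that are uniformly
distributed on `B`. -/
theorem exists_isInvariantProbability {A : Matrix (Fin d) (Fin d) ℤ} (hA : IsExpansive A)
    {B : Finset (Fin d → ℤ)} (hB : B.Nonempty) : ∃ μ, IsInvariantProbability A B μ := by
  have hN0 : (B.card : ℝ≥0∞) ≠ 0 := by simpa using hB.ne_empty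
  have hNtop : (B.card : ℝ≥0∞) ≠ ⊤ := ENNReal.natCast_ne_top _
  let ν : Measure B := (B.card : ℝ≥0∞)⁻¹ • ∑ b : B, Measure.dirac b
  have hνapp : ∀ t : Set B, MeasurableSet t →
      ν t = (B.card : ℝ≥0∞)⁻¹ * ∑ b : B, t.indicator 1 b := by
    intro t ht
    simp [ν, Measure.dirac_apply' _ ht]
  have hνp : IsProbabilityMeasure ν := by
    constructor
    rw [hνapp _ MeasurableSet.univ]
    simp [ENNReal.inv_mul_cancel hN0 hNtop]
  let π : Measure (ℕ → B) := Measure.infinitePi (fun _ => ν)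
  let cons : B → (ℕ → B) → (ℕ → B) := fun b ω n => Nat.casesOn n b ω
  have hcons : ∀ b, Measurable (cons b) := by
    intro b
    refine measurable_pi_lambda _ fun n => ?_
    cases n with
    | zero => exact measurable_const
    | succ k => exact measurable_pi_apply k
  have hshift : (B.card : ℝ≥0∞)⁻¹ • ∑ b : B, π.map (cons b) = π := by
    refine Measure.eq_infinitePi _ fun s t ht => ?_
    classical
    let t' : ℕ → Set B := fun i => if i ∈ s then t i else Set.univ
    have ht' : ∀ i, MeasurableSet (t' i) := by
      intro i
      by_cases hi : i ∈ s
      · simpa [t', hi] using ht i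
      · simp [t', hi]
    obtain ⟨n, hn⟩ := s.exists_nat_subset_range
    have hsn : s ⊆ Finset.range (n + 1) :=
      hn.trans (Finset.range_subset_range.2 (Nat.le_succ n))
    have hprod : ∏ i ∈ s, ν (t i) = ∏ i ∈ Finset.range (n + 1), ν (t' i) := by
      rw [← Finset.prod_subset hsn]
      · refine Finset.prod_congr rfl fun i hi => ?_
        simp [t', hi]
      · intro i _ hi
        simp [t', hi]
    have hset : Set.pi (s : Set ℕ) t = Set.pi (Finset.range (n + 1) : Set ℕ) t' := by
      ext ω
      simp only [Set.mem_pi, Finset.mem_coe]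
      constructor
      · intro h i _
        by_cases his : i ∈ s
        · simpa [t', his] using h i his
        · simp [t', his]
      · intro h i hi
        simpa [t', hi] using h i (hsn hi)
    have hmeas : MeasurableSet (Set.pi (Finset.range (n + 1) : Set ℕ) t') :=
      MeasurableSet.pi (Finset.countable_toSet _) fun i _ => ht' i
    have hpre : ∀ b : B, π (cons b ⁻¹' Set.pi (Finset.range (n + 1) : Set ℕ) t') =
        (t' 0).indicator 1 b * ∏ i ∈ Finset.range n, ν (t' (i + 1)) := by
      intro b
      by_cases hb : b ∈ t' 0
      · have : cons b ⁻¹' Set.pi (Finset.range (n + 1) : Set ℕ) t' =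
            Set.pi (Finset.range n : Set ℕ) (fun i => t' (i + 1)) := by
          ext ω
          simp only [Set.mem_preimage, Set.mem_pi, Finset.mem_coe, Finset.mem_range]
          constructor
          · intro h i hi
            exact h (i + 1) (by omega)
          · intro h i hi
            cases i with
            | zero => exact hb
            | succ k => exact h k (by omega)
        rw [this, Measure.infinitePi_pi _ (fun i _ => ht' (i + 1))]
        simp [hb]
      · have : cons b ⁻¹' Set.pi (Finset.range (n + 1) : Set ℕ) t' = ∅ := by
          ext ω
          simp only [Set.mem_preimage, Set.mem_pi, Finset.mem_coe, Finset.mem_range,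
            Set.mem_empty_iff_false, iff_false]
          intro h
          exact hb (h 0 (by omega))
        rw [this]
        simp [hb]
    rw [hprod, hset, Finset.prod_range_succ', Measure.smul_apply, Measure.finsetSum_apply]
    simp_rw [Measure.map_apply (hcons _) hmeas, hpre]
    rw [← Finset.sum_mul, hνapp _ (ht' 0), smul_eq_mul]
    ring
  let v : B → E d := fun b => vec (b : Fin d → ℤ)
  obtain ⟨C, hC⟩ : ∃ C : ℝ, ∀ b : B, ‖v b‖ ≤ C := by
    obtain ⟨C, hC⟩ := (Set.finite_range fun b : B => ‖v b‖).bddAbove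
    exact ⟨C, fun b => hC ⟨b, rfl⟩⟩
  let T := invCLM A
  have hsum : ∀ ω : ℕ → B, Summable fun k => (T ^ (k + 1)) (v (ω k)) := by
    intro ω
    refine Summable.of_norm_bounded
      (((summable_nat_add_iff 1).2 (summable_norm_invCLM_pow hA)).mul_right C) fun k => ?_
    exact (ContinuousLinearMap.le_opNorm _ _).trans
      (mul_le_mul_of_nonneg_left (hC _) (norm_nonneg _))
  let X : (ℕ → B) → E d := fun ω => ∑' k, (T ^ (k + 1)) (v (ω k))
  have hv : Measurable v := measurable_of_countable _
  have hX : Measurable X := by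
    refine measurable_of_tendsto_metrizable
      (f := fun n ω => ∑ k ∈ Finset.range n, (T ^ (k + 1)) (v (ω k))) (fun n => ?_) ?_
    · refine Finset.measurable_sum _ fun k _ => ?_
      exact (T ^ (k + 1)).continuous.measurable.comp (hv.comp (measurable_pi_apply k))
    · rw [tendsto_pi_nhds]
      intro ω
      exact (hsum ω).hasSum.tendsto_sum_nat
  have hXcons : ∀ b ω, X (cons b ω) = tau A (b : Fin d → ℤ) (X ω) := by
    intro b ω
    have h0 := (hsum (cons b ω)).tsum_eq_zero_add
    have h1 : ∑' k, (T ^ (k + 1 + 1)) (v (cons b ω (k + 1))) = T (X ω) := by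
      rw [ContinuousLinearMap.map_tsum T (hsum ω)]
      refine tsum_congr fun k => ?_
      rw [pow_succ' T (k + 1)]
      rfl
    have h2 : (T ^ (0 + 1)) (v (cons b ω 0)) = T (v b) := by
      rw [zero_add, pow_one]
      rfl
    change ∑' k, (T ^ (k + 1)) (v (cons b ω k)) = T (X ω + v b)
    rw [h0, h1, h2, map_add, add_comm]
  refine ⟨π.map X, Measure.isProbabilityMeasure_map hX.aemeasurable, fun S hS => ?_⟩
  rw [Measure.map_apply hX hS]
  conv_lhs => rw [← hshift]
  rw [Measure.smul_apply, Measure.finsetSum_apply, smul_eq_mul]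
  congr 1
  rw [← Finset.sum_coe_sort B (fun b => (π.map X) (tau A b ⁻¹' S))]
  refine Finset.sum_congr rfl fun b _ => ?_
  rw [Measure.map_apply (hcons b) (hX hS),
    Measure.map_apply hX (measurable_tau A b hS)]
  congr 1
  ext ω
  simp only [Set.mem_preimage, hXcons]

theorem IsInvariantProbability.charFun_eq {A : Matrix (Fin d) (Fin d) ℤ}
    {B : Finset (Fin d → ℤ)} {μ : Measure (E d)} (hμ : IsInvariantProbability A B μ) (t : E d) :
    charFun μ t = ((B.card : ℂ)⁻¹ *
      ∑ b ∈ B, Complex.exp ((⟪invCLM A (vec b), t⟫ : ℝ) * Complex.I)) *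
        charFun μ ((invCLM A).adjoint t) := by
  have := hμ.1
  have hμeq : μ = (B.card : ℝ≥0∞)⁻¹ • ∑ b ∈ B, μ.map (tau A b) := by
    ext S hS
    rw [hμ.2 S hS, Measure.smul_apply, Measure.finsetSum_apply, smul_eq_mul]
    congr 1
    exact Finset.sum_congr rfl fun b _ => (Measure.map_apply (measurable_tau A b) hS).symm
  have hb : ∀ b, ∫ x, Complex.exp ((⟪x, t⟫ : ℝ) * Complex.I) ∂(μ.map (tau A b)) =
      Complex.exp ((⟪invCLM A (vec b), t⟫ : ℝ) * Complex.I) *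
        charFun μ ((invCLM A).adjoint t) := by
    intro b
    rw [integral_map (measurable_tau A b).aemeasurable
      (by fun_prop), charFun_apply, ← integral_const_mul]
    congr 1
    ext x
    rw [← Complex.exp_add, tau, map_add, inner_add_left, ContinuousLinearMap.adjoint_inner_right]
    congr 1
    push_cast
    ring
  have hmap : ∀ b, IsProbabilityMeasure (μ.map (tau A b)) := fun b =>
    Measure.isProbabilityMeasure_map (measurable_tau A b).aemeasurable
  conv_lhs => rw [hμeq]
  rw [charFun_apply, integral_smul_measure, integral_finsetSum_measure]
  · simp_rw [hb]
    rw [← Finset.sum_mul, mul_assoc]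
    simp [Algebra.smul_def]
  · intro b _
    refine Integrable.of_bound (C := 1) (by fun_prop) (ae_of_all _ fun x => ?_)
    rw [Complex.norm_exp_ofReal_mul_I]

theorem IsInvariantProbability.unique {A : Matrix (Fin d) (Fin d) ℤ} (hA : IsExpansive A)
    {B : Finset (Fin d → ℤ)} {μ ν : Measure (E d)} (hμ : IsInvariantProbability A B μ)
    (hν : IsInvariantProbability A B ν) : μ = ν := by
  have := hμ.1
  have := hν.1
  refine Measure.ext_of_charFun (funext fun t => ?_)
  let S := (invCLM A).adjoint
  let D : E d → ℂ := fun t => charFun μ t - charFun ν t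
  have hstep : ∀ t, ‖D t‖ ≤ ‖D (S t)‖ := by
    intro t
    have h1 : D t = ((B.card : ℂ)⁻¹ *
      ∑ b ∈ B, Complex.exp ((⟪invCLM A (vec b), t⟫ : ℝ) * Complex.I)) * D (S t) := by
      simp only [D]
      rw [hμ.charFun_eq t, hν.charFun_eq t]
      simp only [S]
      ring
    rw [h1, norm_mul]
    refine mul_le_of_le_one_left (norm_nonneg _) ?_
    rw [norm_mul, norm_inv, Complex.norm_natCast]
    have h2 : ‖∑ b ∈ B, Complex.exp ((⟪invCLM A (vec b), t⟫ : ℝ) * Complex.I)‖ ≤ B.card := by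
      refine (norm_sum_le _ _).trans ?_
      simp [Complex.norm_exp_ofReal_mul_I]
    rw [inv_mul_eq_div]
    exact div_le_one_of_le₀ h2 (Nat.cast_nonneg _)
  have hiter : ∀ n : ℕ, ‖D t‖ ≤ ‖D ((S ^ n) t)‖ := by
    intro n
    induction n with
    | zero => simp
    | succ k ih =>
      refine ih.trans ((hstep _).trans_eq ?_)
      rw [pow_succ' S k]
      rfl
  have hnorm : ∀ n : ℕ, ‖S ^ n‖ = ‖invCLM A ^ n‖ := by
    intro n
    have : S ^ n = star (invCLM A ^ n) := by
      rw [star_pow]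
      rfl
    rw [this]
    exact LinearIsometryEquiv.norm_map ContinuousLinearMap.adjoint _
  have hlim : Tendsto (fun n : ℕ => (S ^ n) t) atTop (𝓝 0) := by
    have h0 := (summable_norm_invCLM_pow hA).tendsto_atTop_zero.mul_const ‖t‖
    rw [zero_mul] at h0
    refine squeeze_zero_norm (fun n => ?_) h0
    rw [← hnorm n]
    exact ContinuousLinearMap.le_opNorm _ _
  have hcont : ∀ (ρ : Measure (E d)) [IsProbabilityMeasure ρ], Continuous (charFun ρ) := by
    intro ρ _
    have : charFun ρ = fun t => ∫ x, Complex.exp ((⟪x, t⟫ : ℝ) * Complex.I) ∂ρ := by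
      ext t
      rw [charFun_apply]
    rw [this]
    refine continuous_of_dominated (bound := fun _ => 1) (fun t => by fun_prop)
      (fun t => ae_of_all _ fun x => ?_) (integrable_const _) (ae_of_all _ fun x => by fun_prop)
    rw [Complex.norm_exp_ofReal_mul_I]
  have hD0 : Tendsto (fun n : ℕ => ‖D ((S ^ n) t)‖) atTop (𝓝 0) := by
    have hDc : Continuous D := (hcont μ).sub (hcont ν)
    have h1 := (hDc.norm.tendsto 0).comp hlim
    have h2 : ‖D 0‖ = 0 := by simp [D]
    rwa [h2] at h1
  have : ‖D t‖ ≤ 0 := ge_of_tendsto' hD0 hiter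
  exact sub_eq_zero.1 (norm_le_zero_iff.1 this)

theorem existsUnique_isInvariantProbability {A : Matrix (Fin d) (Fin d) ℤ} (hA : IsExpansive A)
    {B : Finset (Fin d → ℤ)} (hB : B.Nonempty) : ∃! μ, IsInvariantProbability A B μ := by
  obtain ⟨μ, hμ⟩ := exists_isInvariantProbability hA hB
  exact ⟨μ, hμ, fun ν hν => hν.unique hA hμ⟩

end Existence

/-- The invariant measure `μ_B` of the affine iterated function system `(τ_b)_{b ∈ B}`: the unique
Borel probability measure satisfying the invariance equation. -/
noncomputable def invariantMeasure {d : ℕ} {A : Matrix (Fin d) (Fin d) ℤ} (hA : IsExpansive A)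
    {B : Finset (Fin d → ℤ)} (hB : B.Nonempty) : Measure (E d) :=
  (existsUnique_isInvariantProbability hA hB).choose

theorem isInvariantProbability_invariantMeasure {d : ℕ} {A : Matrix (Fin d) (Fin d) ℤ}
    (hA : IsExpansive A) {B : Finset (Fin d → ℤ)} (hB : B.Nonempty) :
    IsInvariantProbability A B (invariantMeasure hA hB) :=
  (existsUnique_isInvariantProbability hA hB).choose_spec.1

end AffineIFS

open AffineIFS

/-! Both conditions are read off from Q(x) = ∑_{λ ∈ Λ₀} |μ̂(x + λ)|², the Bessel sum of e_{-x}
against the exponentials from Λ₀. Invariance of μ gives the refinement equation μ̂(t) = m_B(s) μ̂(s)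
with s = (Aᵀ)⁻¹ t. Unitarity enters twice: orthogonal columns make the exponentials from Λ₀
orthonormal (`IsHadamardTriple.orthonormal`), and orthogonal rows give ∑_l |m_B(σ_l x)|² = 1, so R
is an averaging operator. The sums Q_n over n digits satisfy Q_{n+1} = R Q_n
(`IsHadamardTriple.energy_succ`), hence R Q = Q; moreover Q is continuous, Q ≤ 1 and Q(0) = 1.

If R fixes only constants among continuous functions, then Q = 1 everywhere. Every exponential then
attains equality in Bessel's inequality, and since all exponentials together are total in L²(μ), the
family is complete (`IsHadamardTriple.isSpectrum`).

Conversely, a spectrum forces Q = 1 by Parseval. For a continuous fixed point f, the function g = f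
- f(0) satisfies |g| ≤ M (1 - Q_n) (`IsHadamardTriple.exists_norm_le_one_sub_energy`): for n = 0 by
following the branch l = 0 to its attracting point 0, where g vanishes; for larger n by applying R.
Letting n → ∞ gives g = 0. -/

namespace AffineIFS

/-! ### Integer vectors and the inverse matrix -/

section Lattice

variable {d : ℕ}

theorem vec_add (v w : Fin d → ℤ) : vec (v + w) = vec v + vec w := by
  ext i; simp [vec]

theorem vec_sub (v w : Fin d → ℤ) : vec (v - w) = vec v - vec w := by
  ext i; simp [vec]

@[simp] theorem vec_zero : vec (0 : Fin d → ℤ) = 0 := by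
  ext i; simp [vec]

theorem vec_injective : Function.Injective (vec : (Fin d → ℤ) → E d) := by
  intro v w h
  ext i
  have := congrArg (fun x : E d => x i) h
  simpa [vec] using this

theorem adjoint_invCLM (A : Matrix (Fin d) (Fin d) ℤ) : (invCLM A).adjoint = invCLM Aᵀ := by
  rw [← ContinuousLinearMap.star_eq_adjoint, invCLM, invCLM, ← map_star,
    Matrix.star_eq_conjTranspose, Matrix.conjTranspose_nonsing_inv]
  congr 2

theorem inner_invCLM (A : Matrix (Fin d) (Fin d) ℤ) (x y : E d) :
    ⟪invCLM A x, y⟫ = ⟪x, invCLM Aᵀ y⟫ := by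
  rw [← adjoint_invCLM, ContinuousLinearMap.adjoint_inner_right]

theorem summable_norm_invCLM_transpose_pow {A : Matrix (Fin d) (Fin d) ℤ} (hA : IsExpansive A) :
    Summable fun n : ℕ => ‖invCLM Aᵀ ^ n‖ := by
  refine (summable_norm_invCLM_pow hA).congr fun n => ?_
  rw [← adjoint_invCLM, ← ContinuousLinearMap.star_eq_adjoint, ← star_pow]
  exact (LinearIsometryEquiv.norm_map ContinuousLinearMap.adjoint _).symm

theorem tendsto_invCLM_transpose_pow {A : Matrix (Fin d) (Fin d) ℤ} (hA : IsExpansive A)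
    (x : E d) : Filter.Tendsto (fun n : ℕ => (invCLM Aᵀ ^ n) x) Filter.atTop (𝓝 0) := by
  have h := (summable_norm_invCLM_transpose_pow hA).tendsto_atTop_zero.mul_const ‖x‖
  rw [zero_mul] at h
  exact squeeze_zero_norm (fun n => ContinuousLinearMap.le_opNorm _ _) h

theorem IsExpansive.det_ne_zero {A : Matrix (Fin d) (Fin d) ℤ} (hA : IsExpansive A) :
    A.det ≠ 0 := by
  have hunit : IsUnit (A.map (Int.cast : ℤ → ℂ)) := by
    rw [← spectrum.zero_notMem_iff ℂ]
    intro h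
    have := hA 0 h
    simp at this
    linarith
  intro h
  have h2 := ((Matrix.isUnit_iff_isUnit_det _).1 hunit).ne_zero
  have h3 := RingHom.map_det (Int.castRingHom ℂ) A
  rw [h, map_zero] at h3
  exact h2 h3.symm

theorem invCLM_vec_mulVec {A : Matrix (Fin d) (Fin d) ℤ} (hA : A.det ≠ 0) (k : Fin d → ℤ) :
    invCLM A (vec (A *ᵥ k)) = vec k := by
  have hdet : IsUnit (A.map (Int.cast : ℤ → ℝ)).det := by
    have h3 := RingHom.map_det (Int.castRingHom ℝ) A
    have h4 : (A.map (Int.cast : ℤ → ℝ)).det = (A.det : ℝ) := h3.symm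
    rw [h4, isUnit_iff_ne_zero]
    exact_mod_cast hA
  have hv : (fun i => (((A *ᵥ k) i : ℤ) : ℝ)) =
      A.map (Int.cast : ℤ → ℝ) *ᵥ (fun i => (k i : ℝ)) := by
    ext i
    simp [Matrix.mulVec, dotProduct]
  rw [invCLM, vec, Matrix.toEuclideanCLM_toLp, hv, Matrix.mulVec_mulVec,
    Matrix.nonsing_inv_mul _ hdet, Matrix.one_mulVec, vec]

end Lattice

/-! ### Exponentials and periodicity of the filter -/

section Exponential

variable {d : ℕ}

theorem expo_add_right (x y z : E d) : expo x (y + z) = expo x y * expo x z := by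
  rw [expo, expo, expo, ← Complex.exp_add, inner_add_right]
  push_cast
  ring_nf

theorem expo_comm (x y : E d) : expo x y = expo y x := by
  rw [expo, expo, real_inner_comm]

theorem expo_add_left (x y z : E d) : expo (x + y) z = expo x z * expo y z := by
  rw [expo_comm, expo_add_right, expo_comm z x, expo_comm z y]

@[simp] theorem expo_zero_left (x : E d) : expo 0 x = 1 := by
  simp [expo]

@[simp] theorem expo_zero_right (x : E d) : expo x 0 = 1 := by
  simp [expo]

@[simp] theorem norm_expo (x y : E d) : ‖expo x y‖ = 1 := by
  rw [expo, Complex.norm_exp]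
  simp

theorem star_expo (x y : E d) : star (expo x y) = expo (-x) y := by
  rw [Complex.star_def, expo, expo, ← Complex.exp_conj]
  simp [map_ofNat]

theorem continuous_expo_right (x : E d) : Continuous (expo x) := by
  unfold expo
  fun_prop

theorem continuous_expo_left (x : E d) : Continuous fun t => expo t x := by
  unfold expo
  fun_prop

theorem expo_invCLM (A : Matrix (Fin d) (Fin d) ℤ) (x y : E d) :
    expo (invCLM A x) y = expo x (invCLM Aᵀ y) := by
  rw [expo, expo, inner_invCLM]

theorem expo_vec_vec (v w : Fin d → ℤ) : expo (vec v) (vec w) = 1 := by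
  rw [expo, Complex.exp_eq_one_iff]
  refine ⟨∑ i, w i * v i, ?_⟩
  have : (⟪vec v, vec w⟫ : ℝ) = ((∑ i, w i * v i : ℤ) : ℝ) := by
    simp [vec, PiLp.inner_apply]
  rw [this]
  push_cast
  ring

theorem lowPass_add_vec (B : Finset (Fin d → ℤ)) (x : E d) (k : Fin d → ℤ) :
    lowPass B (x + vec k) = lowPass B x := by
  simp_rw [lowPass, expo_add_right, expo_vec_vec, mul_one]

end Exponential

/-! ### Consequences of unitarity for the filter -/

section Hadamard

variable {d : ℕ} {A : Matrix (Fin d) (Fin d) ℤ} {B L : Finset (Fin d → ℤ)}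

/-- This value of m_B is an off-diagonal entry of H* H, which vanishes because the columns of H are
orthogonal. -/
theorem IsHadamardTriple.lowPass_sub (h : IsHadamardTriple A B L) {l l' : Fin d → ℤ}
    (hl : l ∈ L) (hl' : l' ∈ L) (hne : l ≠ l') :
    lowPass B (invCLM Aᵀ (vec l - vec l')) = 0 := by
  have h1 := congrFun (congrFun h.2.2 ⟨l', hl'⟩) ⟨l, hl⟩
  rw [Matrix.one_apply_ne (by simpa using hne.symm), Matrix.mul_apply] at h1
  have hN : (((1 / √(B.card : ℝ) : ℝ) : ℂ)) * ((1 / √(B.card : ℝ) : ℝ) : ℂ) = (B.card : ℂ)⁻¹ := by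
    rw [← Complex.ofReal_mul, div_mul_div_comm, Real.mul_self_sqrt (Nat.cast_nonneg _)]
    simp
  rw [← h1, lowPass, ← Finset.sum_coe_sort B, Finset.mul_sum]
  refine Finset.sum_congr rfl fun b _ => ?_
  simp only [Matrix.conjTranspose_apply, hadamardMatrix, Matrix.of_apply, star_mul']
  rw [expo_comm _ (vec l'), star_expo, expo_comm (-vec l'), Complex.star_def, Complex.conj_ofReal,
    ← expo_invCLM, sub_eq_add_neg, expo_add_right, ← hN]
  ring

/-- Up to the factor N^{-1/2}, the numbers m_B(σ_l x) are the coordinates of c H, where c has N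
unimodular entries. Since H H* = 1, the squared norm of c H is that of c, namely N. -/
theorem IsHadamardTriple.sum_norm_lowPass_sq (h : IsHadamardTriple A B L) (hB : B.Nonempty)
    (x : E d) : ∑ l ∈ L, ‖lowPass B (sigma A l x)‖ ^ 2 = 1 := by
  have hc0 : (B.card : ℝ) ≠ 0 := by simpa using hB.ne_empty
  have hN : (((1 / √(B.card : ℝ) : ℝ) : ℂ)) * ((1 / √(B.card : ℝ) : ℝ) : ℂ) = (B.card : ℂ)⁻¹ := by
    rw [← Complex.ofReal_mul, div_mul_div_comm, Real.mul_self_sqrt (Nat.cast_nonneg _)]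
    simp
  let c : B → ℂ := fun b => expo (vec b) (invCLM Aᵀ x)
  let s : ℂ := ((1 / √(B.card : ℝ) : ℝ) : ℂ)
  have hm : ∀ l : L, lowPass B (sigma A l x) = s * (c ᵥ* hadamardMatrix A B L) l := by
    intro l
    rw [lowPass, sigma, map_add, ← hN, ← Finset.sum_coe_sort B]
    simp only [Matrix.vecMul, dotProduct, hadamardMatrix, Matrix.of_apply, c, s, Finset.mul_sum]
    refine Finset.sum_congr rfl fun b _ => ?_
    rw [expo_add_right, ← expo_invCLM A _ (vec (l : Fin d → ℤ))]
    ring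
  have key : (c ᵥ* hadamardMatrix A B L) ⬝ᵥ star (c ᵥ* hadamardMatrix A B L) = B.card := by
    rw [Matrix.star_vecMul, Matrix.dotProduct_mulVec, Matrix.vecMul_vecMul, h.2.1,
      Matrix.vecMul_one, dotProduct]
    simp [c, Complex.mul_conj, Complex.normSq_eq_norm_sq]
  have h2 : ((∑ l ∈ L, ‖lowPass B (sigma A l x)‖ ^ 2 : ℝ) : ℂ) = 1 := by
    rw [← Finset.sum_coe_sort L]
    push_cast
    have : ∀ l : L, (‖lowPass B (sigma A l x)‖ : ℂ) ^ 2 =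
        (s * s) * ((c ᵥ* hadamardMatrix A B L) l * star (c ᵥ* hadamardMatrix A B L) l) := by
      intro l
      rw [← Complex.mul_conj', hm, map_mul, Complex.conj_ofReal, Pi.star_apply, Complex.star_def]
      ring
    simp_rw [this]
    rw [← Finset.mul_sum]
    change (s * s) * ((c ᵥ* hadamardMatrix A B L) ⬝ᵥ star (c ᵥ* hadamardMatrix A B L)) = 1
    rw [key]
    simp only [s]
    rw [hN]
    exact inv_mul_cancel₀ (by exact_mod_cast hc0)
  exact_mod_cast h2

end Hadamard

/-! ### Fourier transform of the invariant measure -/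

section Fourier

variable {d : ℕ}

/-- The Fourier transform `t ↦ ∫ e^{2π i t · x} dμ(x)`. -/
noncomputable def fourier (μ : Measure (E d)) (t : E d) : ℂ := ∫ x, expo t x ∂μ

theorem fourier_eq_charFun (μ : Measure (E d)) (t : E d) :
    fourier μ t = charFun μ ((2 * Real.pi) • t) := by
  rw [fourier, charFun_apply]
  congr 1
  ext x
  rw [expo, real_inner_smul_right, real_inner_comm]
  congr 1
  push_cast
  ring

theorem continuous_fourier (μ : Measure (E d)) [IsFiniteMeasure μ] : Continuous (fourier μ) :=
  continuous_of_dominated (bound := fun _ => 1)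
    (fun t => (continuous_expo_right t).aestronglyMeasurable)
    (fun t => ae_of_all _ fun x => (norm_expo t x).le) (integrable_const _)
    (ae_of_all _ fun x => continuous_expo_left x)

theorem fourier_zero (μ : Measure (E d)) [IsProbabilityMeasure μ] : fourier μ 0 = 1 := by
  simp [fourier]

theorem norm_fourier_neg (μ : Measure (E d)) (t : E d) : ‖fourier μ (-t)‖ = ‖fourier μ t‖ := by
  have : fourier μ (-t) = (starRingEnd ℂ) (fourier μ t) := by
    rw [fourier, fourier, ← integral_conj]
    congr 1
    ext x
    rw [← star_expo, Complex.star_def]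
  rw [this, Complex.norm_conj]

theorem IsInvariantProbability.fourier_eq {A : Matrix (Fin d) (Fin d) ℤ}
    {B : Finset (Fin d → ℤ)} {μ : Measure (E d)} (hμ : IsInvariantProbability A B μ) (t : E d) :
    fourier μ t = lowPass B (invCLM Aᵀ t) * fourier μ (invCLM Aᵀ t) := by
  rw [fourier_eq_charFun, hμ.charFun_eq, fourier_eq_charFun, adjoint_invCLM, map_smul, lowPass]
  congr 2
  refine Finset.sum_congr rfl fun b _ => ?_
  rw [← expo_invCLM, expo, real_inner_smul_right]
  congr 1
  push_cast
  ring

end Fourier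

/-! ### Digit expansions, orthogonality and partial energies -/

section Digits

variable {d : ℕ}

/-- The finite sums `∑_{k < n} (Aᵀ)^k l_k` with digits `l_k ∈ L`. -/
def digitSums (A : Matrix (Fin d) (Fin d) ℤ) (L : Finset (Fin d → ℤ)) :
    ℕ → Finset (Fin d → ℤ)
  | 0 => {0}
  | n + 1 => Finset.image₂ (fun l k => l + Aᵀ *ᵥ k) L (digitSums A L n)

variable {A : Matrix (Fin d) (Fin d) ℤ} {B L : Finset (Fin d → ℤ)}

theorem mem_digitSums (hL : L.Nonempty) (n : ℕ) (v : Fin d → ℤ) :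
    v ∈ digitSums A L n ↔ ∃ l : ℕ → Fin d → ℤ, (∀ k, l k ∈ L) ∧
      v = ∑ k ∈ Finset.range n, (Aᵀ ^ k) *ᵥ l k := by
  induction n generalizing v with
  | zero =>
    -- Digit sequences are infinite even when no digit is used, so some element of L must fill them.
    obtain ⟨l, hl⟩ := hL
    simp only [digitSums, Finset.mem_singleton, Finset.range_zero, Finset.sum_empty]
    exact ⟨fun h => ⟨fun _ => l, fun _ => hl, h⟩, fun ⟨_, _, h⟩ => h⟩
  | succ n ih =>
    have hstep : ∀ l : ℕ → Fin d → ℤ, ∑ k ∈ Finset.range (n + 1), (Aᵀ ^ k) *ᵥ l k =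
        l 0 + Aᵀ *ᵥ ∑ k ∈ Finset.range n, (Aᵀ ^ k) *ᵥ l (k + 1) := by
      intro l
      rw [Finset.sum_range_succ', Matrix.mulVec_sum, add_comm]
      simp [pow_succ']
    simp only [digitSums, Finset.mem_image₂]
    constructor
    · rintro ⟨l, hl, k, hk, rfl⟩
      obtain ⟨s, hs, rfl⟩ := (ih k).1 hk
      refine ⟨fun j => Nat.casesOn j l s, fun j => ?_, ?_⟩
      · cases j with
        | zero => exact hl
        | succ j => exact hs j
      · exact (hstep fun j => Nat.casesOn j l s).symm
    · rintro ⟨l, hl, rfl⟩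
      exact ⟨l 0, hl 0, _, (ih _).2 ⟨fun k => l (k + 1), fun k => hl _, rfl⟩, (hstep l).symm⟩

theorem zero_mem_digitSums (h0 : 0 ∈ L) (n : ℕ) : 0 ∈ digitSums A L n :=
  (mem_digitSums ⟨0, h0⟩ n 0).2 ⟨fun _ => 0, fun _ => h0, by simp⟩

/-- An expansion is lengthened by a leading digit 0. -/
theorem digitSums_mono (h0 : 0 ∈ L) : Monotone (digitSums A L) := by
  refine monotone_nat_of_le_succ fun n => ?_
  induction n with
  | zero =>
    rw [digitSums, Finset.singleton_subset_iff]
    exact zero_mem_digitSums h0 1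
  | succ n ih => exact Finset.image₂_subset_left ih

theorem mem_lambdaZero (h0 : 0 ∈ L) (x : E d) :
    x ∈ lambdaZero A L ↔ ∃ n, ∃ v ∈ digitSums A L n, x = vec v := by
  constructor
  · rintro ⟨n, l, hl, rfl⟩
    exact ⟨n + 1, _, (mem_digitSums ⟨0, h0⟩ _ _).2 ⟨l, hl, rfl⟩, rfl⟩
  · rintro ⟨n, v, hv, rfl⟩
    -- In `lambdaZero` the index n stands for n + 1 digits, hence the padding by one digit.
    obtain ⟨l, hl, hv⟩ := (mem_digitSums ⟨0, h0⟩ _ _).1 (digitSums_mono h0 n.le_succ hv)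
    exact ⟨n, l, hl, congrArg vec hv⟩

theorem invCLM_transpose_vec_mulVec (hA : IsExpansive A) (k : Fin d → ℤ) :
    invCLM Aᵀ (vec (Aᵀ *ᵥ k)) = vec k :=
  invCLM_vec_mulVec (by rw [Matrix.det_transpose]; exact hA.det_ne_zero) k

theorem lowPass_zero (hB : B.Nonempty) : lowPass B (0 : E d) = 1 := by
  have hc0 : (B.card : ℂ) ≠ 0 := by simpa using hB.ne_empty
  simp [lowPass, hc0]

theorem lowPass_vec (hB : B.Nonempty) (k : Fin d → ℤ) : lowPass B (vec k) = 1 := by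
  rw [← zero_add (vec k), lowPass_add_vec, lowPass_zero hB]

/-- Distinct digits are incongruent modulo Aᵀℤ^d: otherwise (Aᵀ)⁻¹(l - l') would be an integer
vector, where m_B equals 1, whereas orthogonality makes m_B vanish there. -/
theorem IsHadamardTriple.add_mulVec_injective (h : IsHadamardTriple A B L) (hA : IsExpansive A)
    (hB : B.Nonempty) {l l' k k' : Fin d → ℤ} (hl : l ∈ L) (hl' : l' ∈ L)
    (he : l + Aᵀ *ᵥ k = l' + Aᵀ *ᵥ k') : l = l' ∧ k = k' := by
  have h1 : l - l' = Aᵀ *ᵥ (k' - k) := by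
    rw [Matrix.mulVec_sub, sub_eq_sub_iff_add_eq_add, he, add_comm]
  have hll : l = l' := by
    by_contra hne
    have h2 := h.lowPass_sub hl hl' hne
    rw [← vec_sub, h1, invCLM_transpose_vec_mulVec hA, lowPass_vec hB] at h2
    exact one_ne_zero h2
  subst hll
  refine ⟨rfl, vec_injective ?_⟩
  rw [← invCLM_transpose_vec_mulVec hA k, add_left_cancel he, invCLM_transpose_vec_mulVec hA]

theorem sigma_add_mulVec (hA : IsExpansive A) (l k : Fin d → ℤ) (x : E d) :
    invCLM Aᵀ (x + vec (l + Aᵀ *ᵥ k)) = sigma A l x + vec k := by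
  rw [vec_add, ← add_assoc, map_add, invCLM_transpose_vec_mulVec hA, sigma]

/-- The refinement equation strips the lowest digits. If they differ, the filter factor vanishes; if
they agree, they cancel and shorter expansions remain. -/
theorem IsHadamardTriple.fourier_sub_eq_zero (h : IsHadamardTriple A B L) (hA : IsExpansive A)
    {μ : Measure (E d)} (hμ : IsInvariantProbability A B μ) (n : ℕ)
    {v w : Fin d → ℤ} (hv : v ∈ digitSums A L n) (hw : w ∈ digitSums A L n) (hne : v ≠ w) :
    fourier μ (vec v - vec w) = 0 := by
  induction n generalizing v w with
  | zero =>
    simp only [digitSums, Finset.mem_singleton] at hv hw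
    exact absurd (hv.trans hw.symm) hne
  | succ n ih =>
    simp only [digitSums, Finset.mem_image₂] at hv hw
    obtain ⟨l, hl, k, hk, rfl⟩ := hv
    obtain ⟨l', hl', k', hk', rfl⟩ := hw
    have h1 : invCLM Aᵀ (vec (l + Aᵀ *ᵥ k) - vec (l' + Aᵀ *ᵥ k')) =
        invCLM Aᵀ (vec l - vec l') + vec (k - k') := by
      rw [map_sub, map_sub, vec_add, vec_add, map_add, map_add, invCLM_transpose_vec_mulVec hA,
        invCLM_transpose_vec_mulVec hA, vec_sub]
      abel
    rw [hμ.fourier_eq, h1, lowPass_add_vec]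
    by_cases hll : l = l'
    · subst hll
      rw [sub_self, map_zero, zero_add, vec_sub, ih hk hk' (by rintro rfl; exact hne rfl),
        mul_zero]
    · rw [h.lowPass_sub hl hl' hll, zero_mul]

/-- The partial sums `∑_{λ} |μ̂ (x + λ)|²` over the digit sums of length `n`. -/
noncomputable def energy (A : Matrix (Fin d) (Fin d) ℤ) (L : Finset (Fin d → ℤ))
    (μ : Measure (E d)) (n : ℕ) (x : E d) : ℝ :=
  ∑ v ∈ digitSums A L n, ‖fourier μ (x + vec v)‖ ^ 2

theorem energy_zero (μ : Measure (E d)) (x : E d) :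
    energy A L μ 0 x = ‖fourier μ x‖ ^ 2 := by
  simp [energy, digitSums]

/-- This is Q_{n+1} = R Q_n: split off the lowest digit, which is uniquely determined, apply the
refinement equation, and drop the remaining integer vector from m_B by periodicity. -/
theorem IsHadamardTriple.energy_succ (h : IsHadamardTriple A B L) (hA : IsExpansive A)
    (hB : B.Nonempty) {μ : Measure (E d)} (hμ : IsInvariantProbability A B μ) (n : ℕ) (x : E d) :
    energy A L μ (n + 1) x =
      ∑ l ∈ L, ‖lowPass B (sigma A l x)‖ ^ 2 * energy A L μ n (sigma A l x) := by
  rw [energy, digitSums, ← Finset.image_uncurry_product, Finset.sum_image, Finset.sum_product]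
  · refine Finset.sum_congr rfl fun l _ => ?_
    rw [energy, Finset.mul_sum]
    refine Finset.sum_congr rfl fun k _ => ?_
    simp only [Function.uncurry]
    rw [hμ.fourier_eq, sigma_add_mulVec hA, lowPass_add_vec, norm_mul, mul_pow]
  · rintro ⟨l, k⟩ hk ⟨l', k'⟩ hk' he
    simp only [Finset.coe_product, Set.mem_prod, Finset.mem_coe] at hk hk'
    obtain ⟨h1, h2⟩ := h.add_mulVec_injective hA hB hk.1 hk'.1 he
    exact Prod.ext h1 h2

end Digits

/-! ### Continuous fixed points of the transfer operator -/

section Harmonic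

variable {d : ℕ} {A : Matrix (Fin d) (Fin d) ℤ} {B L : Finset (Fin d → ℤ)}

/-- Every point lies in a bounded set that is invariant under all maps `σ_l`. -/
theorem exists_isBounded_invariant (hA : IsExpansive A) (L : Finset (Fin d → ℤ)) (x : E d) :
    ∃ S : Set (E d), Bornology.IsBounded S ∧ x ∈ S ∧ ∀ l ∈ L, ∀ y ∈ S, sigma A l y ∈ S := by
  obtain rfl | ⟨l₀, hl₀⟩ := L.eq_empty_or_nonempty
  · exact ⟨{x}, Bornology.isBounded_singleton, rfl, by simp⟩
  set T := invCLM Aᵀ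
  have hT := summable_norm_invCLM_transpose_pow hA
  obtain ⟨C, hC⟩ : ∃ C : ℝ, ∀ l ∈ L, ‖(vec l : E d)‖ ≤ C := by
    obtain ⟨C, hC⟩ := (L.finite_toSet.image fun l => ‖(vec l : E d)‖).bddAbove
    exact ⟨C, fun l hl => hC ⟨l, hl, rfl⟩⟩
  have hC0 : 0 ≤ C := (norm_nonneg _).trans (hC l₀ hl₀)
  -- The orbit of x under all compositions of the σ_l. It is bounded because the norms of the powers
  -- of T are summable.
  refine ⟨{y | ∃ (n : ℕ) (l : ℕ → Fin d → ℤ), (∀ k, l k ∈ L) ∧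
    y = (T ^ n) x + ∑ k ∈ Finset.range n, (T ^ (k + 1)) (vec (l k))}, ?_, ?_, ?_⟩
  · set K := ∑' n, ‖T ^ n‖
    refine (isBounded_iff_forall_norm_le).2 ⟨K * ‖x‖ + K * C, ?_⟩
    rintro _ ⟨n, l, hl, rfl⟩
    refine (norm_add_le _ _).trans (add_le_add ?_ ?_)
    · exact (ContinuousLinearMap.le_opNorm _ _).trans (mul_le_mul_of_nonneg_right
        (hT.le_tsum n fun _ _ => norm_nonneg _) (norm_nonneg _))
    · calc ‖∑ k ∈ Finset.range n, (T ^ (k + 1)) (vec (l k))‖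
          ≤ ∑ k ∈ Finset.range n, ‖T ^ (k + 1)‖ * C :=
            norm_sum_le_of_le _ fun k _ => (ContinuousLinearMap.le_opNorm _ _).trans
              (mul_le_mul_of_nonneg_left (hC _ (hl k)) (norm_nonneg _))
        _ = (∑ k ∈ Finset.range n, ‖T ^ (k + 1)‖) * C := by rw [Finset.sum_mul]
        _ ≤ K * C := by
            refine mul_le_mul_of_nonneg_right ?_ hC0
            refine le_trans ?_ (hT.sum_le_tsum (Finset.range (n + 1)) fun _ _ => norm_nonneg _)
            rw [Finset.sum_range_succ']
            exact le_add_of_nonneg_right (norm_nonneg _)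
  · exact ⟨0, fun _ => l₀, fun _ => hl₀, by simp⟩
  · rintro l hl _ ⟨n, s, hs, rfl⟩
    refine ⟨n + 1, fun j => Nat.casesOn j l s, fun j => ?_, ?_⟩
    · cases j with
      | zero => exact hl
      | succ j => exact hs j
    · rw [Finset.sum_range_succ']
      simp only [sigma, map_add, map_sum, pow_succ', T, zero_add, pow_zero, mul_one]
      abel

theorem norm_transferOperator_le (g : E d → ℂ) (y : E d) :
    ‖transferOperator A B L g y‖ ≤
      ∑ l ∈ L, ‖lowPass B (sigma A l y)‖ ^ 2 * ‖g (sigma A l y)‖ := by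
  refine norm_sum_le_of_le _ fun l _ => ?_
  rw [norm_mul, Complex.norm_real, Real.norm_of_nonneg (by positivity)]

theorem sigma_zero (y : E d) : sigma A 0 y = invCLM Aᵀ y := by
  rw [sigma, vec_zero, add_zero]

/-- The weights |m_B(σ_l y)|² sum to 1; the branch l = 0 is kept and all others are bounded by M. -/
theorem IsHadamardTriple.norm_le_of_fixed (h : IsHadamardTriple A B L) (h0B : 0 ∈ B)
    (h0L : 0 ∈ L) {S : Set (E d)} (hS : ∀ l ∈ L, ∀ y ∈ S, sigma A l y ∈ S) {g : E d → ℂ} {M : ℝ}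
    (hM : ∀ y ∈ S, ‖g y‖ ≤ M) (hfix : transferOperator A B L g = g) {y : E d} (hy : y ∈ S) :
    ‖lowPass B (invCLM Aᵀ y)‖ ^ 2 ≤ 1 ∧
      ‖g y‖ ≤ ‖lowPass B (invCLM Aᵀ y)‖ ^ 2 * ‖g (invCLM Aᵀ y)‖ +
        (1 - ‖lowPass B (invCLM Aᵀ y)‖ ^ 2) * M := by
  have hw := h.sum_norm_lowPass_sq ⟨0, h0B⟩ y
  have h1 := norm_transferOperator_le (A := A) (B := B) (L := L) g y
  rw [hfix] at h1
  rw [← Finset.add_sum_erase _ _ h0L, sigma_zero] at hw h1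
  have h2 : ∑ l ∈ L.erase 0, ‖lowPass B (sigma A l y)‖ ^ 2 * ‖g (sigma A l y)‖ ≤
      (∑ l ∈ L.erase 0, ‖lowPass B (sigma A l y)‖ ^ 2) * M := by
    rw [Finset.sum_mul]
    exact Finset.sum_le_sum fun l hl => mul_le_mul_of_nonneg_left
      (hM _ (hS l (Finset.mem_of_mem_erase hl) y hy)) (by positivity)
  have h3 : 0 ≤ ∑ l ∈ L.erase 0, ‖lowPass B (sigma A l y)‖ ^ 2 :=
    Finset.sum_nonneg fun l _ => by positivity
  rw [eq_sub_of_add_eq' hw] at h2 h3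
  exact ⟨sub_nonneg.1 h3, h1.trans (add_le_add_right h2 _)⟩

/-- The excess of |g| over the bound does not decrease along y ↦ (Aᵀ)⁻¹ y. This orbit tends to 0,
where g = 0 and μ̂ = 1, so by continuity the excess is zero. -/
theorem IsHadamardTriple.norm_le_one_sub_norm_fourier (h : IsHadamardTriple A B L)
    (hA : IsExpansive A) (h0B : 0 ∈ B) (h0L : 0 ∈ L) {μ : Measure (E d)}
    (hμ : IsInvariantProbability A B μ) {S : Set (E d)}
    (hS : ∀ l ∈ L, ∀ y ∈ S, sigma A l y ∈ S) {g : E d → ℂ} (hg : Continuous g) (hg0 : g 0 = 0)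
    {M : ℝ} (hM : ∀ y ∈ S, ‖g y‖ ≤ M) (hfix : transferOperator A B L g = g) {y : E d}
    (hy : y ∈ S) : ‖g y‖ ≤ M * (1 - ‖fourier μ y‖ ^ 2) := by
  have := hμ.1
  -- Truncation at 0 makes w * D ≤ D valid for a weight w in [0, 1].
  let D : E d → ℝ := fun y => max (‖g y‖ - M * (1 - ‖fourier μ y‖ ^ 2)) 0
  have hDc : Continuous D := by
    have := continuous_fourier μ
    fun_prop
  have hstep : ∀ y ∈ S, D y ≤ D (invCLM Aᵀ y) := by
    intro y hy
    obtain ⟨hw1, hgy⟩ := h.norm_le_of_fixed h0B h0L hS hM hfix hy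
    have hw0 : 0 ≤ ‖lowPass B (invCLM Aᵀ y)‖ ^ 2 := by positivity
    refine max_le ?_ (le_max_right _ _)
    rw [hμ.fourier_eq, norm_mul, mul_pow]
    generalize ‖lowPass B (invCLM Aᵀ y)‖ ^ 2 = w at hw0 hw1 hgy ⊢
    calc ‖g y‖ - M * (1 - w * ‖fourier μ (invCLM Aᵀ y)‖ ^ 2)
        ≤ w * ‖g (invCLM Aᵀ y)‖ + (1 - w) * M - M * (1 - w * ‖fourier μ (invCLM Aᵀ y)‖ ^ 2) :=
          sub_le_sub_right hgy _
      _ = w * (‖g (invCLM Aᵀ y)‖ - M * (1 - ‖fourier μ (invCLM Aᵀ y)‖ ^ 2)) := by ring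
      _ ≤ w * D (invCLM Aᵀ y) := mul_le_mul_of_nonneg_left (le_max_left _ _) hw0
      _ ≤ D (invCLM Aᵀ y) := mul_le_of_le_one_left (le_max_right _ _) hw1
  have hiter : ∀ n : ℕ, (invCLM Aᵀ ^ n) y ∈ S ∧ D y ≤ D ((invCLM Aᵀ ^ n) y) := by
    intro n
    induction n with
    | zero => exact ⟨by simpa using hy, by simp⟩
    | succ n ih =>
      rw [pow_succ']
      exact ⟨sigma_zero (A := A) ((invCLM Aᵀ ^ n) y) ▸ hS 0 h0L _ ih.1,
        ih.2.trans (hstep _ ih.1)⟩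
  have hD0 : D 0 = 0 := by simp [D, hg0, fourier_zero]
  have hlim := (hDc.tendsto 0).comp (tendsto_invCLM_transpose_pow hA y)
  rw [hD0] at hlim
  have h1 : D y ≤ 0 := ge_of_tendsto' hlim fun n => (hiter n).2
  exact sub_nonpos.1 ((le_max_left _ _).trans h1)

/-- A continuous fixed point of the transfer operator that vanishes at `0` is dominated by
`1 - ∑_λ |μ̂ (x + λ)|²`. -/
theorem IsHadamardTriple.exists_norm_le_one_sub_energy (h : IsHadamardTriple A B L)
    (hA : IsExpansive A) (h0B : 0 ∈ B) (h0L : 0 ∈ L) {μ : Measure (E d)}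
    (hμ : IsInvariantProbability A B μ) {g : E d → ℂ} (hg : Continuous g) (hg0 : g 0 = 0)
    (hfix : transferOperator A B L g = g) (x : E d) :
    ∃ M : ℝ, ∀ n, ‖g x‖ ≤ M * (1 - energy A L μ n x) := by
  have hB : B.Nonempty := ⟨0, h0B⟩
  -- The induction on n moves the point by every σ_l, so M has to serve a whole invariant set;
  -- boundedness of that set makes M finite although g may be unbounded.
  obtain ⟨S, hSb, hxS, hS⟩ := exists_isBounded_invariant hA L x
  obtain ⟨M, hM⟩ : ∃ M : ℝ, ∀ y ∈ S, ‖g y‖ ≤ M := by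
    obtain ⟨M, hM⟩ := (hSb.isCompact_closure.image hg.norm).bddAbove
    exact ⟨M, fun y hy => hM ⟨y, subset_closure hy, rfl⟩⟩
  have hall : ∀ (n : ℕ), ∀ y ∈ S, ‖g y‖ ≤ M * (1 - energy A L μ n y) := by
    intro n
    induction n with
    | zero =>
      intro y hy
      rw [energy_zero]
      exact h.norm_le_one_sub_norm_fourier hA h0B h0L hμ hS hg hg0 hM hfix hy
    | succ n ih =>
      intro y hy
      calc ‖g y‖ = ‖transferOperator A B L g y‖ := by rw [hfix]
        _ ≤ ∑ l ∈ L, ‖lowPass B (sigma A l y)‖ ^ 2 * ‖g (sigma A l y)‖ :=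
            norm_transferOperator_le g y
        _ ≤ ∑ l ∈ L, ‖lowPass B (sigma A l y)‖ ^ 2 *
              (M * (1 - energy A L μ n (sigma A l y))) :=
            Finset.sum_le_sum fun l hl =>
              mul_le_mul_of_nonneg_left (ih _ (hS l hl y hy)) (by positivity)
        _ = M * (∑ l ∈ L, ‖lowPass B (sigma A l y)‖ ^ 2 - energy A L μ (n + 1) y) := by
            rw [h.energy_succ hA hB hμ, ← Finset.sum_sub_distrib, Finset.mul_sum]
            exact Finset.sum_congr rfl fun l _ => by ring
        _ = M * (1 - energy A L μ (n + 1) y) := by rw [h.sum_norm_lowPass_sq hB]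
  exact ⟨M, fun n => hall n x hxS⟩

theorem IsHadamardTriple.transferOperator_const (h : IsHadamardTriple A B L) (hB : B.Nonempty)
    (c : ℂ) : transferOperator A B L (fun _ => c) = fun _ => c := by
  ext x
  rw [transferOperator, ← Finset.sum_mul, ← Complex.ofReal_sum, h.sum_norm_lowPass_sq hB,
    Complex.ofReal_one, one_mul]

end Harmonic

/-! ### Equality in Bessel's inequality -/

section Hilbert

theorem hasSum_norm_inner_hilbertBasis_sq {ι H : Type*} [NormedAddCommGroup H]
    [InnerProductSpace ℂ H] (b : HilbertBasis ι ℂ H) (x : H) :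
    HasSum (fun i => ‖inner ℂ (b i) x‖ ^ 2) (‖x‖ ^ 2) := by
  have h := lp.hasSum_norm (p := 2) (by simp) (b.repr x)
  simpa [HilbertBasis.repr_apply_apply] using h

variable {ι H : Type*} [NormedAddCommGroup H] [InnerProductSpace ℂ H] [CompleteSpace H]
  {v : ι → H}

/-- The analysis operator `x ↦ (⟪v i, x⟫)_i` of an orthonormal family. -/
noncomputable def analysis (hv : Orthonormal ℂ v) : H →L[ℂ] lp (fun _ : ι => ℂ) 2 :=
  hv.orthogonalFamily.linearIsometry.toContinuousLinearMap.adjoint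

theorem analysis_apply (hv : Orthonormal ℂ v) (x : H) (i : ι) :
    analysis hv x i = inner ℂ (v i) x := by
  classical
  have h : inner ℂ (lp.single 2 i (1 : ℂ)) (analysis hv x) = inner ℂ (v i) x := by
    rw [analysis, ContinuousLinearMap.adjoint_inner_right,
      LinearIsometry.coe_toContinuousLinearMap, OrthogonalFamily.linearIsometry_apply_single]
    simp
  rw [← h, lp.inner_single_left]
  simp

theorem hasSum_norm_inner_sq (hv : Orthonormal ℂ v) (x : H) :
    HasSum (fun i => ‖inner ℂ (v i) x‖ ^ 2) (‖analysis hv x‖ ^ 2) := by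
  have h := lp.hasSum_norm (p := 2) (by simp) (analysis hv x)
  simpa [analysis_apply] using h

theorem norm_analysis_le (hv : Orthonormal ℂ v) (x : H) : ‖analysis hv x‖ ≤ ‖x‖ := by
  refine (ContinuousLinearMap.le_opNorm _ _).trans (mul_le_of_le_one_left (norm_nonneg _) ?_)
  rw [analysis, LinearIsometryEquiv.norm_map]
  exact LinearIsometry.norm_toContinuousLinearMap_le _

/-- A vector attaining equality in Bessel's inequality is orthogonal to every vector that is
orthogonal to the family. -/
theorem inner_eq_zero_of_norm_analysis_eq (hv : Orthonormal ℂ v) {x u : H}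
    (hx : ‖analysis hv x‖ = ‖x‖) (hu : ∀ i, inner ℂ (v i) u = 0) : inner ℂ x u = 0 := by
  set V := hv.orthogonalFamily.linearIsometry.toContinuousLinearMap with hV
  -- As V is isometric with adjoint `analysis`, ‖V V* x - x‖² = ‖x‖² - ‖V* x‖², which is 0 here.
  have h1 : V (analysis hv x) = x := by
    rw [← sub_eq_zero, ← norm_eq_zero, ← sq_eq_zero_iff, norm_sub_sq (𝕜 := ℂ),
      ← ContinuousLinearMap.adjoint_inner_right]
    change ‖V (analysis hv x)‖ ^ 2 - 2 * RCLike.re (inner ℂ (analysis hv x) (analysis hv x)) +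
      ‖x‖ ^ 2 = 0
    rw [hV, LinearIsometry.coe_toContinuousLinearMap, LinearIsometry.norm_map,
      inner_self_eq_norm_sq, hx]
    ring
  have h2 : analysis hv u = 0 := by
    ext i
    rw [analysis_apply, hu]
    rfl
  rw [← h1, ← ContinuousLinearMap.adjoint_inner_right]
  change inner ℂ (analysis hv x) (analysis hv u) = 0
  rw [h2, inner_zero_right]

end Hilbert

/-! ### Uniqueness of Fourier transforms of integrable densities -/

section Totality

variable {d : ℕ} {μ : Measure (E d)}

theorem ext_of_fourier {μ ν : Measure (E d)} [IsFiniteMeasure μ] [IsFiniteMeasure ν]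
    (h : ∀ t, fourier μ t = fourier ν t) : μ = ν := by
  refine Measure.ext_of_charFun (funext fun t => ?_)
  have h1 := h ((2 * Real.pi)⁻¹ • t)
  rwa [fourier_eq_charFun, fourier_eq_charFun, smul_inv_smul₀ (by positivity)] at h1

theorem fourier_withDensity {g : E d → ℝ} (hg : Integrable g μ) (t : E d) :
    fourier (μ.withDensity fun x => ENNReal.ofReal (g x)) t =
      ∫ x, ((max (g x) 0 : ℝ) : ℂ) * expo t x ∂μ := by
  rw [fourier, integral_withDensity_eq_integral_toReal_smul₀ hg.aemeasurable.ennreal_ofReal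
    (ae_of_all _ fun x => ENNReal.ofReal_lt_top)]
  rfl

theorem integrable_mul_expo {f : E d → ℂ} (hf : Integrable f μ) (t : E d) :
    Integrable (fun x => f x * expo t x) μ :=
  hf.mul_bdd (c := 1) (continuous_expo_right t).aestronglyMeasurable
    (ae_of_all _ fun x => (norm_expo t x).le)

/-- The positive and negative parts of g are densities of two finite measures with the same Fourier
transform, so they agree almost everywhere; at each point one of them is zero. -/
theorem ae_eq_zero_of_integral_ofReal_mul_expo {g : E d → ℝ} (hg : Integrable g μ)
    (h : ∀ t, ∫ x, (g x : ℂ) * expo t x ∂μ = 0) : g =ᵐ[μ] 0 := by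
  have := isFiniteMeasure_withDensity_ofReal hg.2
  have := isFiniteMeasure_withDensity_ofReal hg.neg.2
  have heq : (μ.withDensity fun x => ENNReal.ofReal (g x)) =
      μ.withDensity fun x => ENNReal.ofReal ((-g) x) := by
    refine ext_of_fourier fun t => ?_
    rw [fourier_withDensity hg, fourier_withDensity hg.neg, ← sub_eq_zero, ← integral_sub, ← h t]
    · congr 1
      ext x
      rw [← sub_mul, ← Complex.ofReal_sub, Pi.neg_apply, max_zero_sub_max_neg_zero_eq_self]
    · exact integrable_mul_expo hg.pos_part.ofReal t
    · exact integrable_mul_expo hg.neg.pos_part.ofReal t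
  rw [withDensity_eq_iff hg.aemeasurable.ennreal_ofReal hg.neg.aemeasurable.ennreal_ofReal
    (ne_top_of_le_ne_top hg.2.ne (lintegral_ofReal_le_lintegral_enorm g))] at heq
  filter_upwards [heq] with x hx
  rcases le_total (g x) 0 with h0 | h0
  · rw [ENNReal.ofReal_of_nonpos h0, eq_comm, ENNReal.ofReal_eq_zero, Pi.neg_apply] at hx
    exact le_antisymm h0 (by simpa using hx)
  · rw [ENNReal.ofReal_of_nonpos (p := (-g) x) (by simpa using h0), ENNReal.ofReal_eq_zero] at hx
    exact le_antisymm hx h0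

theorem ae_eq_zero_of_integral_mul_expo {f : E d → ℂ} (hf : Integrable f μ)
    (h : ∀ t, ∫ x, f x * expo t x ∂μ = 0) : f =ᵐ[μ] 0 := by
  -- Conjugating the hypothesis at -t gives it for the conjugate of f, hence for the real and
  -- imaginary parts.
  have hconj : ∀ t, ∫ x, star (f x) * expo t x ∂μ = 0 := by
    intro t
    have h1 := congrArg star (h (-t))
    rw [star_zero, Complex.star_def, ← integral_conj] at h1
    rw [← h1]
    congr 1
    ext x
    rw [map_mul, ← Complex.star_def, star_expo, neg_neg]
  have hfc : Integrable (fun x => star (f x)) μ := (Complex.conjCLE.toContinuousLinearMap).integrable_comp hf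
  have hre : (fun x => (f x).re) =ᵐ[μ] 0 := by
    refine ae_eq_zero_of_integral_ofReal_mul_expo hf.re fun t => ?_
    have h1 : ∀ x, ((f x).re : ℂ) * expo t x =
        2⁻¹ * (f x * expo t x + star (f x) * expo t x) := by
      intro x
      rw [Complex.re_eq_add_conj, Complex.star_def]
      ring
    simp_rw [h1]
    rw [integral_const_mul, integral_add (integrable_mul_expo hf t) (integrable_mul_expo hfc t),
      h, hconj, add_zero, mul_zero]
  have him : (fun x => (f x).im) =ᵐ[μ] 0 := by
    refine ae_eq_zero_of_integral_ofReal_mul_expo hf.im fun t => ?_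
    have h1 : ∀ x, ((f x).im : ℂ) * expo t x =
        (2 * Complex.I)⁻¹ * (f x * expo t x - star (f x) * expo t x) := by
      intro x
      rw [Complex.im_eq_sub_conj, Complex.star_def]
      ring
    simp_rw [h1]
    rw [integral_const_mul, integral_sub (integrable_mul_expo hf t) (integrable_mul_expo hfc t),
      h, hconj, sub_zero, mul_zero]
  filter_upwards [hre, him] with x h1 h2
  exact Complex.ext h1 h2

end Totality

/-! ### Exponentials as vectors of L²(μ) -/

section ExpoLp

variable {d : ℕ}

theorem memLp_expo (μ : Measure (E d)) [IsFiniteMeasure μ] (t : E d) : MemLp (expo t) 2 μ :=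
  MemLp.of_bound (continuous_expo_right t).aestronglyMeasurable 1
    (ae_of_all _ fun x => (norm_expo t x).le)

/-- The exponential `e_t` as an element of `L²(μ)`. -/
noncomputable def expoLp (μ : Measure (E d)) [IsFiniteMeasure μ] (t : E d) : Lp ℂ 2 μ :=
  (memLp_expo μ t).toLp

theorem coeFn_expoLp (μ : Measure (E d)) [IsFiniteMeasure μ] (t : E d) :
    (expoLp μ t : E d → ℂ) =ᵐ[μ] expo t := MemLp.coeFn_toLp _

theorem inner_expoLp (μ : Measure (E d)) [IsFiniteMeasure μ] (s t : E d) :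
    inner ℂ (expoLp μ s) (expoLp μ t) = fourier μ (t - s) := by
  rw [L2.inner_def, fourier]
  refine integral_congr_ae ?_
  filter_upwards [coeFn_expoLp μ s, coeFn_expoLp μ t] with x hs ht
  rw [hs, ht, RCLike.inner_apply, sub_eq_add_neg, expo_add_left, ← star_expo, Complex.star_def]

theorem norm_expoLp (μ : Measure (E d)) [IsProbabilityMeasure μ] (t : E d) :
    ‖expoLp μ t‖ = 1 := by
  have h : (‖expoLp μ t‖ : ℂ) ^ 2 = 1 := by
    rw [← fourier_zero μ, ← sub_self t, ← inner_expoLp]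
    exact (inner_self_eq_norm_sq_to_K (𝕜 := ℂ) (expoLp μ t)).symm
  have h' : ‖expoLp μ t‖ ^ 2 = 1 := by exact_mod_cast h
  exact (pow_eq_one_iff_of_nonneg (norm_nonneg _) two_ne_zero).1 h'

/-- Since ‖e_t - e_s‖² = 2 - 2 Re μ̂(s - t), this reduces to continuity of μ̂. It yields continuity
of Q without any uniform convergence of the series. -/
theorem continuous_expoLp (μ : Measure (E d)) [IsProbabilityMeasure μ] :
    Continuous (expoLp μ) := by
  refine continuous_iff_continuousAt.2 fun s => tendsto_iff_norm_sub_tendsto_zero.2 ?_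
  have h : ∀ t, ‖expoLp μ t - expoLp μ s‖ = √(2 - 2 * (fourier μ (s - t)).re) := by
    intro t
    rw [← Real.sqrt_sq (norm_nonneg (expoLp μ t - expoLp μ s)), norm_sub_sq (𝕜 := ℂ),
      inner_expoLp, norm_expoLp, norm_expoLp]
    congr 1
    simp only [RCLike.re_eq_complex_re]
    ring
  have hc : Continuous fun t => √(2 - 2 * (fourier μ (s - t)).re) := by
    have := continuous_fourier μ
    fun_prop
  have h1 := hc.tendsto s
  simp_rw [h]
  simpa [fourier_zero] using h1

theorem eq_zero_of_inner_expoLp (μ : Measure (E d)) [IsFiniteMeasure μ] {u : Lp ℂ 2 μ}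
    (h : ∀ t, inner ℂ (expoLp μ t) u = 0) : u = 0 := by
  refine (Lp.eq_zero_iff_ae_eq_zero).2 (ae_eq_zero_of_integral_mul_expo
    ((Lp.memLp u).integrable (by norm_num)) fun t => ?_)
  rw [← h (-t), L2.inner_def]
  refine integral_congr_ae ?_
  filter_upwards [coeFn_expoLp μ (-t)] with x hx
  rw [hx, RCLike.inner_apply, ← Complex.star_def, star_expo, neg_neg]

end ExpoLp

/-! ### The two implications -/

section Spectrum

variable {d : ℕ} {A : Matrix (Fin d) (Fin d) ℤ} {B L : Finset (Fin d → ℤ)}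

/-- The digit sums of length n increase and exhaust Λ₀, so they are cofinal among its finite
subsets. -/
theorem tendsto_sum_digitSums (h0 : 0 ∈ L) {f : E d → ℝ} {a : ℝ}
    (hf : HasSum (fun x : lambdaZero A L => f x) a) :
    Filter.Tendsto (fun n => ∑ v ∈ digitSums A L n, f (vec v)) Filter.atTop (𝓝 a) := by
  classical
  let s : ℕ → Finset (lambdaZero A L) := fun n =>
    ((digitSums A L n).image vec).subtype (· ∈ lambdaZero A L)
  have hs : Filter.Tendsto s Filter.atTop Filter.atTop := by
    refine Filter.tendsto_atTop_finset_of_monotone (fun m n hmn => ?_) fun x => ?_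
    · exact Finset.subtype_mono (Finset.image_subset_image (digitSums_mono h0 hmn))
    · obtain ⟨n, v, hv, hx⟩ := (mem_lambdaZero h0 _).1 x.2
      exact ⟨n, Finset.mem_subtype.2 (Finset.mem_image.2 ⟨v, hv, hx.symm⟩)⟩
  refine (hf.comp hs).congr fun n => ?_
  simp only [Function.comp_apply, s]
  rw [Finset.sum_subtype_of_mem f, Finset.sum_image fun v _ w _ h => vec_injective h]
  intro x hx
  obtain ⟨v, hv, rfl⟩ := Finset.mem_image.1 hx
  exact (mem_lambdaZero h0 _).2 ⟨n, v, hv, rfl⟩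

theorem norm_inner_expoLp_neg (μ : Measure (E d)) [IsFiniteMeasure μ] (s x : E d) :
    ‖inner ℂ (expoLp μ s) (expoLp μ (-x))‖ = ‖fourier μ (x + s)‖ := by
  rw [inner_expoLp, ← norm_fourier_neg μ (x + s), neg_add']

theorem IsHadamardTriple.orthonormal (h : IsHadamardTriple A B L) (hA : IsExpansive A)
    (h0 : 0 ∈ L) {μ : Measure (E d)} [IsProbabilityMeasure μ]
    (hμ : IsInvariantProbability A B μ) :
    Orthonormal ℂ fun x : lambdaZero A L => expoLp μ (x : E d) := by
  refine ⟨fun x => norm_expoLp μ _, fun x y hxy => ?_⟩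
  obtain ⟨m, v, hv, hx⟩ := (mem_lambdaZero h0 _).1 x.2
  obtain ⟨n, w, hw, hy⟩ := (mem_lambdaZero h0 _).1 y.2
  rw [inner_expoLp, hx, hy]
  -- Both expansions are padded to a common length.
  refine h.fourier_sub_eq_zero hA hμ (max m n) (digitSums_mono h0 (le_max_right _ _) hw)
    (digitSums_mono h0 (le_max_left _ _) hv) ?_
  rintro rfl
  exact hxy (Subtype.ext (hx.trans hy.symm))

theorem IsHadamardTriple.fixed_eq_const (h : IsHadamardTriple A B L) (hA : IsExpansive A)
    (h0B : 0 ∈ B) (h0L : 0 ∈ L) {μ : Measure (E d)} (hμ : IsInvariantProbability A B μ)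
    (hspec : IsSpectrum μ (lambdaZero A L)) {f : E d → ℂ} (hf : Continuous f)
    (hfix : transferOperator A B L f = f) (x : E d) : f x = f 0 := by
  have := hμ.1
  obtain ⟨e, he⟩ := hspec
  have he' : ∀ s : lambdaZero A L, e s = expoLp μ (s : E d) := fun s =>
    Lp.ext ((he s).trans (coeFn_expoLp μ _).symm)
  have hsum : HasSum (fun s : lambdaZero A L => ‖fourier μ (x + s)‖ ^ 2) 1 := by
    -- Parseval for e_{-x}: the sign turns the coefficient at s into |μ̂(x + s)|.
    have h1 := hasSum_norm_inner_hilbertBasis_sq e (expoLp μ (-x))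
    simp_rw [he', norm_inner_expoLp_neg, norm_expoLp, one_pow] at h1
    exact h1
  have hlim := tendsto_sum_digitSums h0L (f := fun s => ‖fourier μ (x + s)‖ ^ 2) hsum
  have hgfix : transferOperator A B L (fun y => f y - f 0) = fun y => f y - f 0 := by
    ext y
    have h2 := congrFun hfix y
    have h1 := congrFun (h.transferOperator_const (A := A) (L := L) ⟨0, h0B⟩ (f 0)) y
    simp only [transferOperator] at h1 h2 ⊢
    simp only [mul_sub, Finset.sum_sub_distrib]
    rw [h1, h2]
  obtain ⟨M, hM⟩ := h.exists_norm_le_one_sub_energy hA h0B h0L hμ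
    (hf.sub continuous_const) (sub_self _) hgfix x
  have hzero : Filter.Tendsto (fun n => M * (1 - energy A L μ n x)) Filter.atTop (𝓝 0) := by
    simpa [energy] using (hlim.const_sub 1).const_mul M
  exact sub_eq_zero.1 (norm_le_zero_iff.1 (ge_of_tendsto' hzero hM))

theorem IsHadamardTriple.isSpectrum (h : IsHadamardTriple A B L) (hA : IsExpansive A)
    (h0B : 0 ∈ B) (h0L : 0 ∈ L) {μ : Measure (E d)} (hμ : IsInvariantProbability A B μ)
    (hconst : ∀ f : E d → ℂ, Continuous f → transferOperator A B L f = f →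
      ∃ c : ℂ, ∀ x, f x = c) : IsSpectrum μ (lambdaZero A L) := by
  have hB : B.Nonempty := ⟨0, h0B⟩
  have := hμ.1
  have hv := h.orthonormal hA h0L hμ
  let q : E d → ℝ := fun x => ‖analysis hv (expoLp μ (-x))‖ ^ 2
  have hq : Continuous q :=
    (((analysis hv).continuous.comp ((continuous_expoLp μ).comp continuous_neg)).norm).pow 2
  have hlim : ∀ x, Filter.Tendsto (fun n => energy A L μ n x) Filter.atTop (𝓝 (q x)) := by
    intro x
    have h1 := hasSum_norm_inner_sq hv (expoLp μ (-x))
    simp_rw [norm_inner_expoLp_neg] at h1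
    exact tendsto_sum_digitSums h0L (f := fun s => ‖fourier μ (x + s)‖ ^ 2) h1
  have hqfix : ∀ x, ∑ l ∈ L, ‖lowPass B (sigma A l x)‖ ^ 2 * q (sigma A l x) = q x := by
    intro x
    -- Pass to the limit in Q_{n+1} = R Q_n; the sum over L is finite.
    refine tendsto_nhds_unique ?_ ((hlim x).comp (Filter.tendsto_add_atTop_nat 1))
    simp only [Function.comp_def, h.energy_succ hA hB hμ]
    exact tendsto_finsetSum _ fun l _ => (hlim _).const_mul _
  obtain ⟨c, hc⟩ := hconst (fun x => (q x : ℂ)) (Complex.continuous_ofReal.comp hq) (by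
    ext x
    rw [transferOperator, ← hqfix x]
    push_cast
    rfl)
  have hq0 : q 0 = 1 := by
    refine le_antisymm ?_ ?_
    · refine pow_le_one₀ (norm_nonneg _) ((norm_analysis_le hv _).trans ?_)
      rw [norm_expoLp]
    -- The term λ = 0 alone contributes |μ̂(0)|² = 1.
    · refine ge_of_tendsto' (hlim 0) fun n => ?_
      rw [energy]
      refine le_trans ?_ (Finset.single_le_sum (f := fun v => ‖fourier μ (0 + vec v)‖ ^ 2)
        (fun v _ => by positivity) (zero_mem_digitSums h0L n))
      simp [fourier_zero]
  have hq1 : ∀ x, q x = 1 := by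
    intro x
    have h1 : (q x : ℂ) = q 0 := (hc x).trans (hc 0).symm
    rw [← hq0]
    exact_mod_cast h1
  have hbot : (Submodule.span ℂ
      (Set.range fun x : lambdaZero A L => expoLp μ (x : E d)))ᗮ = ⊥ := by
    -- Since Q(-t) = 1 = ‖e_t‖², every e_t attains equality in Bessel's inequality. So u is
    -- orthogonal to all exponentials and vanishes.
    refine (Submodule.eq_bot_iff _).2 fun u hu => eq_zero_of_inner_expoLp μ fun t => ?_
    refine inner_eq_zero_of_norm_analysis_eq hv ?_ fun i =>
      (Submodule.mem_orthogonal _ _).1 hu _ (Submodule.subset_span ⟨i, rfl⟩)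
    have h1 := hq1 (-t)
    simp only [q, neg_neg] at h1
    rw [norm_expoLp]
    exact (pow_eq_one_iff_of_nonneg (norm_nonneg _) two_ne_zero).1 h1
  refine ⟨HilbertBasis.mkOfOrthogonalEqBot hv hbot, fun s => ?_⟩
  rw [HilbertBasis.coe_mkOfOrthogonalEqBot]
  exact coeFn_expoLp μ _

end Spectrum

end AffineIFS

open AffineIFS

theorem theorem2p16 {d : ℕ} (A : Matrix (Fin d) (Fin d) ℤ) (hA : IsExpansive A)
    (B L : Finset (Fin d → ℤ)) (hABL : IsHadamardTriple A B L)
    (h0B : 0 ∈ B) (h0L : 0 ∈ L) :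
    IsSpectrum (invariantMeasure hA ⟨0, h0B⟩) (lambdaZero A L) ↔
      ∀ f : E d → ℂ, Continuous f →
        (transferOperator A B L f = f ↔ ∃ c : ℂ, ∀ x, f x = c) := by
  have hμ := isInvariantProbability_invariantMeasure hA (B := B) ⟨0, h0B⟩
  constructor
  · refine fun hspec f hf => ⟨fun hfix =>
      ⟨f 0, hABL.fixed_eq_const hA h0B h0L hμ hspec hf hfix⟩, ?_⟩
    rintro ⟨c, hc⟩
    rw [funext hc]
    exact hABL.transferOperator_const ⟨0, h0B⟩ c
  · exact fun hconst => hABL.isSpectrum hA h0B h0L hμ fun f hf => (hconst f hf).1
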